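/- For integers $A,B$ and $q$ not a root of unity let $$\begin{bmatrix}A\\B\end{bmatrix}_q=\frac{(q;q)_A}{(q;q)_B\,(q;q)_{A-B}}\ \text{ if } 0\le B\le A,\qquad \begin{bmatrix}A\\B\end{bmatrix}_q=0\ \text{ otherwise},$$ where $(a;q)_n=\prod_{k=0}^{n-1}(1-aq^k)$, and let $\begin{bmatrix}A\\B\end{bmatrix}_q^{*}=1$ if $A=-1$ and $B=0$, and $\begin{bmatrix}A\\B\end{bmatrix}_q^{*}=\begin{bmatrix}A\\B\end{bmatrix}_q$ otherwise. Let $K$ be a field and let $z,q\in K$ with $z\neq 0$ and $q^m\ne 1$ for all $m\ge 1$ (for instance, $z$ and $q$ are indeterminates and $K=\mathbb{Q}(z,q)$). Then for every integer $n\ge 0$ $$\sum_{j=0}^{\lfloor n/2\rfloor}\sum_{h=0}^{j}\sum_{i=0}^{j}(-1)^{h+i}z^{h-i}q^{h^2+i^2+2j^2}\begin{bmatrix}j\\h\end{bmatrix}_{q^2}\begin{bmatrix}j\\i\end{bmatrix}_{q^2}\begin{bmatrix}j+\lfloor\frac{n-h-i}{2}\rfloor\\2j\end{bmatrix}_{q^2}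 =\sum_{j=-\infty}^{\infty}(-1)^jz^jq^{3j^2}\begin{bmatrix}n-1\\\lfloor\frac{n+3j-1}{2}\rfloor\end{bmatrix}_{q^2}+\epsilon_n(z,q),$$ where $$\epsilon_n(z,q)=\begin{cases}\displaystyle\sum_{j=-\infty}^{\infty}z^{2j}q^{12j^2+6j+n}\begin{bmatrix}n-1\\\frac{n+6j}{2}\end{bmatrix}_{q^2}^{*}&\text{if }2\mid n,\\[3ex]\displaystyle-\sum_{j=-\infty}^{\infty}z^{2j-1}q^{12j^2-6j+n}\begin{bmatrix}n-1\\\frac{n+6j-3}{2}\end{bmatrix}_{q^2}^{*}&\text{if }2\nmid n,\end{cases}$$ and each of the bilateral sums that occurs has only finitely many nonzero terms. -/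

import Mathlib

open Finset

noncomputable section

namespace RamanujanFinite

variable {K : Type*} [Field K]

/-- The rising `q`-factorial `(a; q)_n = (1 - a)(1 - a q) ⋯ (1 - a q ^ (n - 1))`. -/
def qPoch (a q : K) (n : ℕ) : K :=
  ∏ k ∈ range n, (1 - a * q ^ k)

/-- The `q`-binomial coefficient `[A, B]_q` for integers `A`, `B`:
`(q; q)_A / ((q; q)_B (q; q)_{A - B})` if `0 ≤ B ≤ A`, and `0` otherwise. -/
def qBinom (q : K) (A B : ℤ) : K :=
  if 0 ≤ B ∧ B ≤ A then
    qPoch q q A.toNat / (qPoch q q B.toNat * qPoch q q (A - B).toNat)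
  else 0

/-- The modified `q`-binomial coefficient: it is `1` if `A = -1` and `B = 0`, and it agrees with
`qBinom` otherwise. -/
def qBinomStar (q : K) (A B : ℤ) : K :=
  if A = -1 ∧ B = 0 then 1 else qBinom q A B

/-- The triple sum. The quotient `((n : ℤ) - h - i) / 2` is the floor, also for negative
numerators. -/
def tripleSum (n : ℕ) (z q : K) : K :=
  ∑ j ∈ range (n / 2 + 1), ∑ h ∈ range (j + 1), ∑ i ∈ range (j + 1),
    (-1) ^ (h + i) * z ^ ((h : ℤ) - (i : ℤ)) * q ^ (h ^ 2 + i ^ 2 + 2 * j ^ 2) *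
      qBinom (q ^ 2) j h * qBinom (q ^ 2) j i *
      qBinom (q ^ 2) ((j : ℤ) + ((n : ℤ) - h - i) / 2) (2 * (j : ℤ))

/-- The `j`-th term of the main bilateral sum (integer division is the floor). -/
def mainTerm (n : ℕ) (z q : K) (j : ℤ) : K :=
  (-1) ^ j * z ^ j * q ^ (3 * j ^ 2) * qBinom (q ^ 2) ((n : ℤ) - 1) (((n : ℤ) + 3 * j - 1) / 2)

/-- The `j`-th term of the bilateral sum in the correction for even `n`. -/
def evenTerm (n : ℕ) (z q : K) (j : ℤ) : K :=
  z ^ (2 * j) * q ^ (12 * j ^ 2 + 6 * j + (n : ℤ)) *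
    qBinomStar (q ^ 2) ((n : ℤ) - 1) (((n : ℤ) + 6 * j) / 2)

/-- The `j`-th term of the bilateral sum in the correction for odd `n`. -/
def oddTerm (n : ℕ) (z q : K) (j : ℤ) : K :=
  z ^ (2 * j - 1) * q ^ (12 * j ^ 2 - 6 * j + (n : ℤ)) *
    qBinomStar (q ^ 2) ((n : ℤ) - 1) (((n : ℤ) + 6 * j - 3) / 2)

/-- The parity-dependent correction `ε_n(z, q)`. -/
def correction (n : ℕ) (z q : K) : K :=
  if 2 ∣ n then ∑ᶠ j : ℤ, evenTerm n z q j else - ∑ᶠ j : ℤ, oddTerm n z q j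

end RamanujanFinite

end

/-!
Both sides are Laurent polynomials in `z`, and the identity holds coefficient by coefficient.
Write `Q = q ^ 2`, `N = ⌊(n - m) / 2⌋`, and let all brackets be taken to the base `Q`.

On the right, the correction term at `z ^ m` is present exactly when `m` has the parity of `n`.
In that case Pascal's rule merges it with the main term, and for either parity the coefficient of
`z ^ m` becomes `(-1) ^ m * q ^ (3 * m ^ 2) * [2 * N + m, N + 2 * m]`
(`mainTerm_add_corrTerm`). The modified bracket is what makes Pascal's rule true for `n = 0`.

On the left, the terms with `z ^ m` are those with `h = i + m`. Exchanging `h` and `i` amounts to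
exchanging `z` and `z⁻¹`, so `m ≥ 0` may be assumed, and one has to show (`sum_coeff`)
`∑ j, ∑ i, Q ^ (i * (i + m) + j ^ 2) * [j, i + m] * [j, i] * [j + N - i, 2 * j]
  = Q ^ (m ^ 2) * [2 * N + m, N + 2 * m]`.
The sum over `i` is a terminating balanced `₃φ₂`, evaluated by the `q`-Saalschütz formula as
`[N + m, N - j] * [N, j - m]` (`sum_saalTerm`); the remaining sum over `j` is a `q`-Vandermonde sum
(`sum_gaussBinom_mul_gaussBinom`).

The `q`-Vandermonde sum follows from Pascal's rule by induction. The `q`-Saalschütz sum is proved by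
induction on `N - j`, with an explicit telescoping certificate (`saalTerm_telescope`). Since `q = 0`
is allowed, exponents are kept in the natural numbers and no step divides by `q`.
-/

open Finset

namespace RamanujanFinite

variable {K : Type*} [Field K]

/-! ### Gaussian binomial coefficients -/

lemma qPoch_self_succ (q : K) (n : ℕ) :
    qPoch q q (n + 1) = qPoch q q n * (1 - q ^ (n + 1)) := by
  rw [qPoch, prod_range_succ, ← qPoch, pow_succ']

lemma one_sub_pow_ne_zero {q : K} (hq : ∀ m : ℕ, 0 < m → q ^ m ≠ 1) (n : ℕ) :
    1 - q ^ (n + 1) ≠ 0 :=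
  sub_ne_zero.2 (hq (n + 1) n.succ_pos).symm

lemma qPoch_self_ne_zero {q : K} (hq : ∀ m : ℕ, 0 < m → q ^ m ≠ 1) (n : ℕ) :
    qPoch q q n ≠ 0 := by
  induction n with
  | zero => simp [qPoch]
  | succ n ih => rw [qPoch_self_succ]; exact mul_ne_zero ih (one_sub_pow_ne_zero hq n)

lemma qBinom_eq_zero {A B : ℤ} (q : K) (h : B < 0 ∨ A < B) : qBinom q A B = 0 := by
  rw [qBinom, if_neg (by omega)]

/-- The Gaussian binomial coefficient with natural-number arguments. -/
def gaussBinom (q : K) (n k : ℕ) : K := qBinom q n k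

lemma gaussBinom_eq_zero {n k : ℕ} (q : K) (h : n < k) : gaussBinom q n k = 0 :=
  qBinom_eq_zero q (by omega)

lemma gaussBinom_add (q : K) (a b : ℕ) :
    gaussBinom q (a + b) a = qPoch q q (a + b) / (qPoch q q a * qPoch q q b) := by
  rw [gaussBinom, qBinom, if_pos (by omega)]
  congr
  omega

lemma gaussBinom_symm (q : K) (a b : ℕ) :
    gaussBinom q (a + b) a = gaussBinom q (a + b) b := by
  rw [gaussBinom_add, add_comm a b, gaussBinom_add, mul_comm]

lemma gaussBinom_zero_right {q : K} (hq : ∀ m : ℕ, 0 < m → q ^ m ≠ 1) (n : ℕ) :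
    gaussBinom q n 0 = 1 := by
  have h := gaussBinom_add q 0 n
  rw [zero_add] at h
  rw [h]
  have := qPoch_self_ne_zero hq n
  rw [show qPoch q q 0 = 1 from prod_range_zero _, one_mul, div_self this]

lemma gaussBinom_self {q : K} (hq : ∀ m : ℕ, 0 < m → q ^ m ≠ 1) (n : ℕ) :
    gaussBinom q n n = 1 := by
  have h := gaussBinom_symm q n 0
  rw [add_zero, gaussBinom_zero_right hq] at h
  exact h

lemma gaussBinom_succ_right {q : K} (hq : ∀ m : ℕ, 0 < m → q ^ m ≠ 1) (n k : ℕ) :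
    (1 - q ^ (k + 1)) * gaussBinom q n (k + 1) = (1 - q ^ (n - k)) * gaussBinom q n k := by
  rcases lt_trichotomy k n with h | rfl | h
  · obtain ⟨b, rfl⟩ := Nat.exists_eq_add_of_lt h
    rw [gaussBinom, show k + b + 1 = (k + 1) + b by ring, ← gaussBinom, gaussBinom_add,
      show k + 1 + b = k + (b + 1) by ring, gaussBinom_add, qPoch_self_succ q k,
      qPoch_self_succ q b, Nat.add_sub_cancel_left]
    have h1 := qPoch_self_ne_zero hq k
    have h2 := qPoch_self_ne_zero hq b
    have h3 := one_sub_pow_ne_zero hq k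
    have h4 := one_sub_pow_ne_zero hq b
    field_simp
  · simp [gaussBinom_eq_zero q (Nat.lt_succ_self k)]
  · rw [gaussBinom_eq_zero q h, gaussBinom_eq_zero q (by omega)]; simp

lemma gaussBinom_succ_left {q : K} (hq : ∀ m : ℕ, 0 < m → q ^ m ≠ 1) (n k : ℕ) :
    (1 - q ^ (n + 1 - k)) * gaussBinom q (n + 1) k = (1 - q ^ (n + 1)) * gaussBinom q n k := by
  rcases Nat.lt_or_ge n k with h | h
  · rw [gaussBinom_eq_zero q h, Nat.sub_eq_zero_of_le h]; simp
  · obtain ⟨b, rfl⟩ := Nat.exists_eq_add_of_le h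
    rw [show k + b + 1 - k = b + 1 by omega, add_assoc, gaussBinom_add, gaussBinom_add,
      ← add_assoc, qPoch_self_succ, qPoch_self_succ q b]
    have h1 := qPoch_self_ne_zero hq k
    have h2 := qPoch_self_ne_zero hq b
    have h4 := one_sub_pow_ne_zero hq b
    field_simp

lemma gaussBinom_succ_succ {q : K} (hq : ∀ m : ℕ, 0 < m → q ^ m ≠ 1) (n k : ℕ) :
    (1 - q ^ (k + 1)) * gaussBinom q (n + 1) (k + 1) =
      (1 - q ^ (n + 1)) * gaussBinom q n k := by
  rcases Nat.lt_or_ge n k with h | h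
  · rw [gaussBinom_eq_zero q h, gaussBinom_eq_zero q (by omega)]; simp
  · obtain ⟨b, rfl⟩ := Nat.exists_eq_add_of_le h
    rw [show k + b + 1 = (k + 1) + b by ring, gaussBinom_add, gaussBinom_add,
      show (k + 1) + b = k + b + 1 by ring, qPoch_self_succ, qPoch_self_succ q k]
    have h1 := qPoch_self_ne_zero hq k
    have h2 := qPoch_self_ne_zero hq b
    have h3 := one_sub_pow_ne_zero hq k
    field_simp

lemma gaussBinom_pascal {q : K} (hq : ∀ m : ℕ, 0 < m → q ^ m ≠ 1) (n k : ℕ) :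
    gaussBinom q (n + 1) (k + 1) =
      gaussBinom q n k + q ^ (k + 1) * gaussBinom q n (k + 1) := by
  rcases Nat.lt_or_ge n k with h | h
  · rw [gaussBinom_eq_zero q h, gaussBinom_eq_zero q (by omega : n < k + 1),
      gaussBinom_eq_zero q (by omega)]; simp
  · obtain ⟨b, rfl⟩ := Nat.exists_eq_add_of_le h
    have h1 := gaussBinom_succ_right hq (k + b) k
    have h2 := gaussBinom_succ_succ hq (k + b) k
    rw [Nat.add_sub_cancel_left] at h1
    apply mul_left_cancel₀ (one_sub_pow_ne_zero hq k)
    linear_combination h2 - q ^ (k + 1) * h1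

lemma gaussBinom_pascal' {q : K} (hq : ∀ m : ℕ, 0 < m → q ^ m ≠ 1) (n k : ℕ) :
    gaussBinom q (n + 1) (k + 1) =
      gaussBinom q n (k + 1) + q ^ (n - k) * gaussBinom q n k := by
  have h1 := gaussBinom_succ_right hq n k
  rw [gaussBinom_pascal hq]
  linear_combination -h1

/-! ### The q-Vandermonde and q-Saalschütz sums -/

/-- The `q`-Vandermonde sum, parametrised so that `[C + d, C - k]` and the exponent `k * (k + d)`
involve no truncated subtraction. -/
theorem sum_gaussBinom_mul_gaussBinom {q : K} (hq : ∀ m : ℕ, 0 < m → q ^ m ≠ 1) (B C d : ℕ) :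
    ∑ k ∈ range (C + 1), q ^ (k * (k + d)) * gaussBinom q (C + d) (C - k) * gaussBinom q B k =
      gaussBinom q (C + d + B) C := by
  induction B generalizing C d with
  | zero =>
    rw [sum_eq_single 0]
    · simp [gaussBinom_zero_right hq]
    · intro k _ hk
      rw [gaussBinom_eq_zero q (Nat.pos_of_ne_zero hk), mul_zero]
    · simp
  | succ B ih =>
    cases C with
    | zero => simp [gaussBinom_zero_right hq]
    | succ C =>
      -- Pascal's rule for `[B + 1, k]` leaves the sum for `(C + 1, d)` and, after a shift of `k`,
      -- `q ^ (B + d + 1)` times the sum for `(C, d + 1)`.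
      have h1 := ih (C + 1) d
      have h2 := ih C (d + 1)
      rw [sum_range_succ'] at h1 ⊢
      rw [← add_assoc, gaussBinom_pascal' hq, ← h1,
        show C + 1 + d + B = C + (d + 1) + B by ring, ← h2, mul_sum,
        gaussBinom_zero_right hq, gaussBinom_zero_right hq, add_right_comm (∑ _ ∈ _, _), ← sum_add_distrib]
      congr 1
      refine sum_congr rfl fun k _ => ?_
      rw [gaussBinom_pascal' hq, Nat.add_sub_add_right,
        show C + 1 + d = C + (d + 1) by ring, show C + (d + 1) + B - C = d + 1 + B by omega]
      rcases Nat.lt_or_ge B k with h | h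
      · rw [gaussBinom_eq_zero q h]; ring
      · obtain ⟨b, rfl⟩ := Nat.exists_eq_add_of_le h
        rw [Nat.add_sub_cancel_left]
        ring

/-- The summand of the `q`-Saalschütz sum, with `j = m + s` and `N = m + s + t` in terms of the
indices of the triple sum. The last factor `[2 * j + t - i, 2 * j]` has integer arguments, so that
it vanishes for all `i > t`. -/
def saalTerm (q : K) (m s t i : ℕ) : K :=
  q ^ (i * (i + m)) * gaussBinom q (m + s) (i + m) * gaussBinom q (m + s) i *
    qBinom q (2 * ((m : ℤ) + s) + t - i) (2 * ((m : ℤ) + s))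

lemma saalTerm_eq_zero_of_lt_left {s i : ℕ} (q : K) (m t : ℕ) (h : s < i) :
    saalTerm q m s t i = 0 := by
  rw [saalTerm, gaussBinom_eq_zero q (by omega : m + s < i + m)]; simp

lemma saalTerm_eq_zero_of_lt_right {t i : ℕ} (q : K) (m s : ℕ) (h : t < i) :
    saalTerm q m s t i = 0 := by
  rw [saalTerm, qBinom_eq_zero q (by omega)]; simp

lemma saalTerm_add (q : K) (m s i b : ℕ) :
    saalTerm q m s (i + b) i = q ^ (i * (i + m)) * gaussBinom q (m + s) (i + m) *
      gaussBinom q (m + s) i * gaussBinom q (2 * (m + s) + b) (2 * (m + s)) := by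
  rw [saalTerm, gaussBinom.eq_1 q (2 * (m + s) + b)]
  congr 2
  push_cast
  ring

lemma saalTerm_succ_left {q : K} (hq : ∀ m : ℕ, 0 < m → q ^ m ≠ 1) (m s i b : ℕ) :
    (1 - q ^ (b + 1)) * saalTerm q m s (i + b + 1) i =
      (1 - q ^ (2 * (m + s) + b + 1)) * saalTerm q m s (i + b) i := by
  rw [add_assoc i, saalTerm_add, saalTerm_add]
  have h := gaussBinom_succ_left hq (2 * (m + s) + b) (2 * (m + s))
  rw [show 2 * (m + s) + b + 1 - 2 * (m + s) = b + 1 by omega] at h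
  rw [← add_assoc (2 * (m + s))]
  linear_combination q ^ (i * (i + m)) * gaussBinom q (m + s) (i + m) *
      gaussBinom q (m + s) i * h

lemma saalTerm_succ_right {q : K} (hq : ∀ m : ℕ, 0 < m → q ^ m ≠ 1) (m a i b : ℕ) :
    (1 - q ^ (i + 1)) * (1 - q ^ (i + 1 + m)) * saalTerm q m (i + a) (i + b + 1) (i + 1) =
      q ^ (2 * i + 1 + m) * (1 - q ^ a) * (1 - q ^ (m + a)) *
        saalTerm q m (i + a) (i + b) i := by
  rw [add_right_comm i b 1, saalTerm_add, saalTerm_add]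
  have h1 := gaussBinom_succ_right hq (m + (i + a)) i
  have h2 := gaussBinom_succ_right hq (m + (i + a)) (i + m)
  rw [show m + (i + a) - i = m + a by omega] at h1
  rw [show m + (i + a) - (i + m) = a by omega, add_right_comm i m 1] at h2
  have h3 : q ^ ((i + 1) * (i + 1 + m)) = q ^ (i * (i + m)) * q ^ (2 * i + 1 + m) := by ring
  rw [h3]
  linear_combination q ^ (i * (i + m)) * q ^ (2 * i + 1 + m) *
    gaussBinom q (2 * (m + (i + a)) + b) (2 * (m + (i + a))) *
    ((1 - q ^ (i + 1 + m)) * gaussBinom q (m + (i + a)) (i + 1 + m) * h1 +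
      (1 - q ^ (m + a)) * gaussBinom q (m + (i + a)) i * h2)

/-- The Wilf–Zeilberger certificate: the first-order recurrence in `t` satisfied by the closed form
of the `q`-Saalschütz sum holds for its summand up to the difference `G (i + 1) - G i`, where
`G i = -q ^ (t + 1 - i) * (1 - q ^ i) * (1 - q ^ (i + m)) * saalTerm q m s (t + 1) i`. The truncated
exponent is harmless, since the summand vanishes for `i > t + 1`. -/
lemma saalTerm_telescope {q : K} (hq : ∀ m : ℕ, 0 < m → q ^ m ≠ 1) (m s t i : ℕ) :
    (1 - q ^ (t + 1)) * (1 - q ^ (m + t + 1)) * saalTerm q m s (t + 1) i -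
      (1 - q ^ (2 * m + s + t + 1)) * (1 - q ^ (m + s + t + 1)) * saalTerm q m s t i =
    -(q ^ (t + 1 - (i + 1)) * (1 - q ^ (i + 1)) * (1 - q ^ (i + 1 + m)) *
        saalTerm q m s (t + 1) (i + 1)) -
      -(q ^ (t + 1 - i) * (1 - q ^ i) * (1 - q ^ (i + m)) * saalTerm q m s (t + 1) i) := by
  rcases Nat.lt_or_ge s i with hs | hs
  · simp [saalTerm_eq_zero_of_lt_left q m _ hs,
      saalTerm_eq_zero_of_lt_left q m _ (Nat.lt_succ_of_lt hs)]
  rcases Nat.lt_or_ge t i with ht | ht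
  · rw [saalTerm_eq_zero_of_lt_right q m s ht,
      saalTerm_eq_zero_of_lt_right q m s (by omega : t + 1 < i + 1)]
    rcases (Nat.succ_le_of_lt ht).eq_or_lt with rfl | ht'
    · rw [Nat.succ_eq_add_one, Nat.sub_self]
      ring
    · rw [saalTerm_eq_zero_of_lt_right q m s ht']; ring
  obtain ⟨a, rfl⟩ := Nat.exists_eq_add_of_le hs
  obtain ⟨b, rfl⟩ := Nat.exists_eq_add_of_le ht
  have h1 := saalTerm_succ_left hq m (i + a) i b
  have h2 := saalTerm_succ_right hq m a i b
  rw [show i + b + 1 - (i + 1) = b by omega, show i + b + 1 - i = b + 1 by omega]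
  linear_combination (1 - q ^ (m + b + 1 + 2 * i)) * h1 + q ^ b * h2

/-- The `q`-Saalschütz sum. The bound `L` is arbitrary beyond the support of the summand. -/
theorem sum_saalTerm {q : K} (hq : ∀ m : ℕ, 0 < m → q ^ m ≠ 1) (m s t L : ℕ) (hL : t < L) :
    ∑ i ∈ range L, saalTerm q m s t i =
      gaussBinom q (2 * m + s + t) t * gaussBinom q (m + s + t) s := by
  induction t with
  | zero =>
    rw [sum_eq_single 0]
    · have h := saalTerm_add q m s 0 0
      simp only [add_zero, zero_add] at h ⊢
      rw [h, gaussBinom_self hq, gaussBinom_zero_right hq, gaussBinom_zero_right hq,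
        gaussBinom_symm]
      simp
    · intro i _ hi
      exact saalTerm_eq_zero_of_lt_right q m s (Nat.pos_of_ne_zero hi)
    · intro h
      exact absurd (mem_range.2 hL) h
  | succ t ih =>
    -- The boundary terms vanish: at `i = 0` by the factor `1 - q ^ 0`, at `i = L` by the support.
    have hsum := sum_congr (rfl : range L = range L) fun i _ => saalTerm_telescope hq m s t i
    rw [sum_sub_distrib, ← mul_sum, ← mul_sum, ih (by omega), sum_range_sub (fun i =>
      -(q ^ (t + 1 - i) * (1 - q ^ i) * (1 - q ^ (i + m)) * saalTerm q m s (t + 1) i)),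
      saalTerm_eq_zero_of_lt_right q m s hL, pow_zero] at hsum
    have h1 := gaussBinom_succ_succ hq (2 * m + s + t) t
    have h2 := gaussBinom_succ_left hq (m + s + t) s
    rw [show m + s + t + 1 - s = m + t + 1 by omega] at h2
    apply mul_left_cancel₀ (mul_ne_zero (one_sub_pow_ne_zero hq t)
      (one_sub_pow_ne_zero hq (m + t)))
    rw [← add_assoc, ← add_assoc]
    linear_combination hsum - (1 - q ^ (m + t + 1)) * gaussBinom q (m + s + t + 1) s * h1
      - (1 - q ^ (2 * m + s + t + 1)) * gaussBinom q (2 * m + s + t) t * h2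

/-- The identity between coefficients of `z ^ m` for `m ≥ 0`, to the base `q ^ 2` (here `q`). Only
`m ≤ j ≤ N` contribute; there the sum over `i` is `q`-Saalschütz and the sum over `j = m + s` is
`q`-Vandermonde. -/
theorem sum_coeff {q : K} (hq : ∀ m : ℕ, 0 < m → q ^ m ≠ 1) (m N J L : ℕ) (hJ : N < J)
    (hL : N < L) :
    ∑ j ∈ range J, ∑ i ∈ range L, q ^ (i * (i + m) + j ^ 2) * gaussBinom q j (i + m) *
      gaussBinom q j i * qBinom q ((j : ℤ) + (N - i)) (2 * j) =
    q ^ m ^ 2 * gaussBinom q (2 * N + m) (N + 2 * m) := by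
  rcases Nat.lt_or_ge N m with hm | hm
  · rw [gaussBinom_eq_zero q (by omega), mul_zero]
    refine sum_eq_zero fun j _ => sum_eq_zero fun i _ => ?_
    rcases Nat.lt_or_ge j m with hj | hj
    · rw [gaussBinom_eq_zero q (by omega : j < i + m)]; simp
    · rw [qBinom_eq_zero q (by omega)]; simp
  obtain ⟨C, rfl⟩ := Nat.exists_eq_add_of_le hm
  -- Only the block `m ≤ j ≤ m + C = N` of the range of `j` contributes.
  obtain ⟨J', rfl⟩ : ∃ J', J = m + (C + 1 + J') := ⟨J - (m + (C + 1)), by omega⟩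
  rw [sum_range_add, sum_eq_zero, zero_add, sum_range_add, add_comm, sum_eq_zero, zero_add]
  · rw [show 2 * (m + C) + m = C + (m + C + 2 * m) by ring,
      ← gaussBinom_symm,
      show C + (m + C + 2 * m) = C + 2 * m + (m + C) by ring,
      ← sum_gaussBinom_mul_gaussBinom hq (m + C) C (2 * m), mul_sum]
    refine sum_congr rfl fun s hs => ?_
    obtain ⟨t, rfl⟩ := Nat.exists_eq_add_of_le (Nat.lt_succ_iff.1 (mem_range.1 hs))
    have h := sum_saalTerm hq m s t L (by omega)
    rw [Nat.add_sub_cancel_left, show s + t + 2 * m = 2 * m + s + t by ring, ← add_assoc m s t,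
      mul_assoc (q ^ _) _ (gaussBinom q (m + s + t) s), ← h, mul_sum, mul_sum]
    refine sum_congr rfl fun i _ => ?_
    rw [saalTerm, show ((m + s : ℕ) : ℤ) + (((m + s + t : ℕ) : ℤ) - i) =
      2 * ((m : ℤ) + s) + t - i by push_cast; ring, Nat.cast_add]
    ring
  · intro j _
    refine sum_eq_zero fun i _ => ?_
    rw [qBinom_eq_zero q (by push_cast; omega)]; simp
  · intro j hj
    refine sum_eq_zero fun i _ => ?_
    rw [gaussBinom_eq_zero q (by have := mem_range.1 hj; omega : j < i + m)]; simp

/-! ### The right-hand side -/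

/-- The term of the right-hand side with `z ^ m`, the correction included:
`(-1) ^ m * z ^ m * q ^ (3 * m ^ 2) * [2 * N + m, N + 2 * m]` with `N = ⌊(n - m) / 2⌋`. -/
def mergedTerm (n : ℕ) (z q : K) (m : ℤ) : K :=
  (-1) ^ m * z ^ m * q ^ (3 * m ^ 2) *
    qBinom (q ^ 2) (2 * (((n : ℤ) - m) / 2) + m) (((n : ℤ) - m) / 2 + 2 * m)

/-- The terms of the correction, indexed for either parity of `n` by the exponent `m` of `z`. It is
`0` unless `m` has the parity of `n`. -/
def corrTerm (n : ℕ) (z q : K) (m : ℤ) : K :=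
  if 2 ∣ (n : ℤ) - m then
    (-1) ^ m * z ^ m * q ^ (3 * m ^ 2 + 3 * m + n) *
      qBinomStar (q ^ 2) ((n : ℤ) - 1) (((n : ℤ) + 3 * m) / 2)
  else 0

lemma qBinomStar_eq_zero {A B : ℤ} (q : K) (h : B < 0 ∨ A < B ∧ B ≠ 0) :
    qBinomStar q A B = 0 := by
  rw [qBinomStar, if_neg (by omega), qBinom_eq_zero q (by omega)]

/-- Pascal's rule; the modified coefficient makes it valid for `n = 0` as well. -/
lemma qBinom_pascal_star {q : K} (hq : ∀ m : ℕ, 0 < m → q ^ m ≠ 1) (n b : ℕ) :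
    qBinom q ((n : ℤ) - 1) ((b : ℤ) - 1) + q ^ b * qBinomStar q ((n : ℤ) - 1) b =
      qBinom q n b := by
  rcases n with _ | n
  · rw [qBinom_eq_zero q (by omega)]
    rcases b with _ | b
    · have := gaussBinom_zero_right hq 0
      rw [gaussBinom] at this
      rw [this]
      simp [qBinomStar]
    · rw [qBinomStar_eq_zero q (by omega), qBinom_eq_zero q (by omega)]; simp
  · rw [qBinomStar, if_neg (by omega), show ((n + 1 : ℕ) : ℤ) - 1 = n by push_cast; ring]
    rcases b with _ | b
    · have h1 := gaussBinom_zero_right hq n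
      have h2 := gaussBinom_zero_right hq (n + 1)
      rw [gaussBinom] at h1 h2
      rw [h1, h2, qBinom_eq_zero q (by omega)]; simp
    · rw [show ((b + 1 : ℕ) : ℤ) - 1 = b by push_cast; ring]
      exact (gaussBinom_pascal hq n b).symm

lemma mainTerm_add_corrTerm {q : K} (hq : ∀ m : ℕ, 0 < m → (q ^ 2) ^ m ≠ 1) (n : ℕ) (z : K)
    (m : ℤ) : mainTerm n z q m + corrTerm n z q m = mergedTerm n z q m := by
  rw [mainTerm, corrTerm, mergedTerm]
  by_cases h : 2 ∣ (n : ℤ) - m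
  · rw [if_pos h]
    obtain ⟨N, hN⟩ := h
    obtain ⟨B, hB⟩ : ∃ B, B = N + 2 * m := ⟨_, rfl⟩
    rw [show ((n : ℤ) - m) / 2 = N by omega, show 2 * N + m = n by omega,
      show ((n : ℤ) + 3 * m) / 2 = B by omega, show ((n : ℤ) + 3 * m - 1) / 2 = B - 1 by omega,
      ← hB]
    rcases lt_or_ge B 0 with hneg | hpos
    · rw [qBinom_eq_zero _ (by omega), qBinom_eq_zero _ (by omega),
        qBinomStar_eq_zero _ (by omega)]; simp
    · obtain ⟨b, rfl⟩ := Int.eq_ofNat_of_zero_le hpos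
      -- `q` may vanish, so the exponents are split as natural numbers.
      have e1 : 3 * m ^ 2 = ((3 * m.natAbs ^ 2 : ℕ) : ℤ) := by push_cast; rw [sq_abs]
      have e2 : 3 * m ^ 2 + 3 * m + n = ((3 * m.natAbs ^ 2 + 2 * b : ℕ) : ℤ) := by
        rw [Nat.cast_add, ← e1]; push_cast; linarith
      rw [e2, e1, zpow_natCast, zpow_natCast, ← qBinom_pascal_star hq n b]
      ring
  · rw [if_neg h, show 2 * (((n : ℤ) - m) / 2) + m = n - 1 by omega,
      show ((n : ℤ) + 3 * m - 1) / 2 = ((n : ℤ) - m) / 2 + 2 * m by omega, add_zero]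

lemma support_mainTerm_subset (n : ℕ) (z q : K) :
    Function.support (mainTerm n z q) ⊆ Set.Icc (-n : ℤ) n := by
  intro m hm
  by_contra hc
  rw [Set.mem_Icc] at hc
  refine hm ?_
  rw [mainTerm, qBinom_eq_zero _ (by omega), mul_zero]

lemma support_corrTerm_subset (n : ℕ) (z q : K) :
    Function.support (corrTerm n z q) ⊆ Set.Icc (-n : ℤ) n := by
  intro m hm
  by_contra hc
  rw [Set.mem_Icc] at hc
  refine hm ?_
  rw [corrTerm]
  split_ifs with h
  · rw [qBinomStar_eq_zero _ (by omega), mul_zero]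
  · rfl

lemma support_mergedTerm_subset (n : ℕ) (z q : K) :
    Function.support (mergedTerm n z q) ⊆ Set.Icc (-n : ℤ) n := by
  intro m hm
  by_contra hc
  rw [Set.mem_Icc] at hc
  refine hm ?_
  rw [mergedTerm, qBinom_eq_zero _ (by omega), mul_zero]

lemma evenTerm_eq_corrTerm {n : ℕ} (hn : 2 ∣ n) (z q : K) (j : ℤ) :
    evenTerm n z q j = corrTerm n z q (2 * j) := by
  rw [evenTerm, corrTerm, if_pos (by omega), (even_two_mul j).neg_one_zpow, one_mul]
  congr 3 <;> ring_nf

lemma neg_oddTerm_eq_corrTerm {n : ℕ} (hn : ¬ 2 ∣ n) (z q : K) (j : ℤ) :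
    -oddTerm n z q j = corrTerm n z q (2 * j - 1) := by
  have hodd : Odd (2 * j - 1) := ⟨j - 1, by ring⟩
  rw [oddTerm, corrTerm, if_pos (by omega), hodd.neg_one_zpow,
    show 3 * (2 * j - 1) ^ 2 + 3 * (2 * j - 1) + (n : ℤ) = 12 * j ^ 2 - 6 * j + n by ring,
    show (n : ℤ) + 3 * (2 * j - 1) = n + 6 * j - 3 by ring]
  ring

lemma finite_support_evenTerm {n : ℕ} (hn : 2 ∣ n) (z q : K) :
    (Function.support (evenTerm n z q)).Finite := by
  refine (Set.finite_Icc (-n : ℤ) n).subset fun j hj => ?_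
  rw [Function.mem_support, evenTerm_eq_corrTerm hn] at hj
  have := support_corrTerm_subset n z q hj
  rw [Set.mem_Icc] at this ⊢
  omega

lemma finite_support_oddTerm {n : ℕ} (hn : ¬ 2 ∣ n) (z q : K) :
    (Function.support (oddTerm n z q)).Finite := by
  refine (Set.finite_Icc (-n : ℤ) n).subset fun j hj => ?_
  rw [Function.mem_support, ← neg_ne_zero, neg_oddTerm_eq_corrTerm hn] at hj
  have := support_corrTerm_subset n z q hj
  rw [Set.mem_Icc] at this ⊢
  omega

lemma correction_eq_finsum_corrTerm (n : ℕ) (z q : K) :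
    correction n z q = ∑ᶠ m : ℤ, corrTerm n z q m := by
  -- The correction is indexed by `m = 2 * j` or `m = 2 * j - 1`; each runs over one parity class.
  have key (g : ℤ → ℤ) (hg : Function.Injective g)
      (hr : ∀ m : ℤ, 2 ∣ (n : ℤ) - m → m ∈ Set.range g) :
      ∑ᶠ j : ℤ, corrTerm n z q (g j) = ∑ᶠ m : ℤ, corrTerm n z q m := by
    rw [← finsum_mem_range hg]
    rw [← finsum_mem_univ (corrTerm n z q)]
    refine finsum_mem_inter_support_eq' _ _ _ fun m hm => iff_of_true (hr m ?_) trivial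
    by_contra hc
    exact hm (by rw [corrTerm, if_neg hc])
  rw [correction]
  split_ifs with hn
  · rw [finsum_congr (evenTerm_eq_corrTerm hn z q)]
    exact key (fun j => 2 * j) (fun a b h => by simpa using h) fun m hm =>
      ⟨m / 2, by change 2 * (m / 2) = m; omega⟩
  · rw [← finsum_neg_distrib, finsum_congr (neg_oddTerm_eq_corrTerm hn z q)]
    exact key (fun j => 2 * j - 1) (fun a b h => by simpa using h) fun m hm =>
      ⟨(m + 1) / 2, by change 2 * ((m + 1) / 2) - 1 = m; omega⟩

lemma finsum_mainTerm_add_correction {q : K} (hq : ∀ m : ℕ, 0 < m → (q ^ 2) ^ m ≠ 1) (n : ℕ)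
    (z : K) : (∑ᶠ j : ℤ, mainTerm n z q j) + correction n z q =
      ∑ m ∈ Icc (-n : ℤ) n, mergedTerm n z q m := by
  rw [correction_eq_finsum_corrTerm, ← finsum_add_distrib
    ((Set.finite_Icc _ _).subset (support_mainTerm_subset n z q))
    ((Set.finite_Icc _ _).subset (support_corrTerm_subset n z q)),
    finsum_congr (mainTerm_add_corrTerm hq n z)]
  exact finsum_eq_sum_of_support_subset _ (by simpa using support_mergedTerm_subset n z q)

/-! ### The left-hand side -/

/-- The contribution of the pair `(h, i)` to the triple sum: its terms with those `h` and `i`, summed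
over `j`. -/
def pairTerm (n : ℕ) (z q : K) (h i : ℕ) : K :=
  ∑ j ∈ range (n / 2 + 1),
    (-1) ^ (h + i) * z ^ ((h : ℤ) - (i : ℤ)) * q ^ (h ^ 2 + i ^ 2 + 2 * j ^ 2) *
      qBinom (q ^ 2) j h * qBinom (q ^ 2) j i *
      qBinom (q ^ 2) ((j : ℤ) + ((n : ℤ) - h - i) / 2) (2 * (j : ℤ))

lemma pairTerm_eq_zero_left {n h : ℕ} (z q : K) (i : ℕ) (hh : n < h) :
    pairTerm n z q h i = 0 := by
  refine sum_eq_zero fun j hj => ?_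
  rw [mem_range] at hj
  rw [qBinom_eq_zero (q ^ 2) (by omega : (h : ℤ) < 0 ∨ (j : ℤ) < h)]; simp

lemma pairTerm_eq_zero_right {n i : ℕ} (z q : K) (h : ℕ) (hi : n < i) :
    pairTerm n z q h i = 0 := by
  refine sum_eq_zero fun j hj => ?_
  rw [mem_range] at hj
  rw [qBinom_eq_zero (q ^ 2) (by omega : (i : ℤ) < 0 ∨ (j : ℤ) < i)]; simp

lemma tripleSum_eq_sum_pairTerm (n : ℕ) (z q : K) :
    tripleSum n z q = ∑ h ∈ range (n + 1), ∑ i ∈ range (n + 1), pairTerm n z q h i := by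
  have hext (j : ℕ) (hj : j ∈ range (n / 2 + 1)) (f : ℕ → K) (hf : ∀ i, j < i → f i = 0) :
      ∑ i ∈ range (j + 1), f i = ∑ i ∈ range (n + 1), f i := by
    rw [mem_range] at hj
    refine sum_subset (range_subset_range.2 (by omega)) fun i _ hi => hf i ?_
    rw [mem_range] at hi
    omega
  simp only [pairTerm]
  rw [sum_congr rfl fun h _ => sum_comm, sum_comm, tripleSum]
  refine sum_congr rfl fun j hj => ?_
  rw [hext j hj]
  · refine sum_congr rfl fun h _ => hext j hj _ fun i hi => ?_
    rw [qBinom_eq_zero (q ^ 2) (by omega : (i : ℤ) < 0 ∨ (j : ℤ) < i)]; simp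
  · intro h hh
    refine sum_eq_zero fun i _ => ?_
    rw [qBinom_eq_zero (q ^ 2) (by omega : (h : ℤ) < 0 ∨ (j : ℤ) < h)]; simp

lemma sum_pairTerm_add {q : K} (hq : ∀ m : ℕ, 0 < m → (q ^ 2) ^ m ≠ 1) {n m : ℕ} (hm : m ≤ n)
    (z : K) : ∑ i ∈ range (n + 1), pairTerm n z q (i + m) i = (-1) ^ m * z ^ m * q ^ (3 * m ^ 2) *
      gaussBinom (q ^ 2) (2 * ((n - m) / 2) + m) ((n - m) / 2 + 2 * m) := by
  have h := sum_coeff hq m ((n - m) / 2) (n / 2 + 1) (n + 1) (by omega) (by omega)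
  simp only [pairTerm]
  rw [sum_comm]
  have e : (-1) ^ m * z ^ m * q ^ (3 * m ^ 2) *
      gaussBinom (q ^ 2) (2 * ((n - m) / 2) + m) ((n - m) / 2 + 2 * m) =
      (-1) ^ m * z ^ m * q ^ m ^ 2 * ((q ^ 2) ^ m ^ 2 *
        gaussBinom (q ^ 2) (2 * ((n - m) / 2) + m) ((n - m) / 2 + 2 * m)) := by ring
  rw [e, ← h, mul_sum]
  refine sum_congr rfl fun j _ => ?_
  rw [mul_sum]
  refine sum_congr rfl fun i _ => ?_
  rw [show ((n : ℤ) - (i + m : ℕ) - i) / 2 = ((n - m) / 2 : ℕ) - i by omega,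
    show ((i + m : ℕ) : ℤ) - i = m by push_cast; ring, zpow_natCast, gaussBinom, gaussBinom,
    show i + m + i = m + 2 * i by ring, pow_add (-1 : K) m, pow_mul (-1 : K) 2 i, neg_one_sq,
    one_pow]
  ring

/-- Exchanging `h` and `i` exchanges `z` and `z⁻¹`, which reduces negative powers of `z` to
positive ones. -/
lemma pairTerm_swap (z q : K) (n h i : ℕ) :
    pairTerm n z q h i = pairTerm n z⁻¹ q i h := by
  refine sum_congr rfl fun j _ => ?_
  rw [add_comm h i, inv_zpow', neg_sub, sub_right_comm, add_comm (h ^ 2)]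
  ring

/-- The terms of the triple sum with `h - i = m` add up to the term of the right-hand side with
`z ^ m`. -/
lemma sum_pairTerm_eq_mergedTerm {q : K} (hq : ∀ m : ℕ, 0 < m → (q ^ 2) ^ m ≠ 1) (n : ℕ) (z : K)
    {m : ℤ} (hm : m ∈ Icc (-n : ℤ) n) :
    ∑ h ∈ range (n + 1), ∑ i ∈ range (n + 1),
      (if (h : ℤ) - i = m then pairTerm n z q h i else 0) = mergedTerm n z q m := by
  rw [mem_Icc] at hm
  obtain ⟨k, rfl | rfl⟩ := m.eq_nat_or_neg
  · rw [sum_comm]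
    trans ∑ i ∈ range (n + 1), pairTerm n z q (i + k) i
    · refine sum_congr rfl fun i _ => ?_
      rw [sum_eq_single (i + k), if_pos (by omega)]
      · intro h _ hh
        rw [if_neg (by omega)]
      · intro hh
        rw [mem_range] at hh
        rw [pairTerm_eq_zero_left z q i (by omega), ite_self]
    · rw [sum_pairTerm_add hq (by omega), mergedTerm, gaussBinom, zpow_natCast, zpow_natCast,
        show (3 * (k : ℤ) ^ 2) = ((3 * k ^ 2 : ℕ) : ℤ) by push_cast; rfl, zpow_natCast]
      congr 2 <;> omega
  · trans ∑ h ∈ range (n + 1), pairTerm n z⁻¹ q (h + k) h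
    · refine sum_congr rfl fun h _ => ?_
      rw [sum_eq_single (h + k), if_pos (by omega), pairTerm_swap]
      · intro i _ hi
        rw [if_neg (by omega)]
      · intro hi
        rw [mem_range] at hi
        rw [pairTerm_eq_zero_right z q h (by omega), ite_self]
    · have hs : gaussBinom (q ^ 2) (2 * ((n - k) / 2) + k) ((n - k) / 2 + 2 * k) =
          qBinom (q ^ 2) (2 * (((n : ℤ) - -k) / 2) + -k) (((n : ℤ) - -k) / 2 + 2 * -k) := by
        rcases Nat.lt_or_ge ((n - k) / 2) k with hk | hk
        · rw [gaussBinom_eq_zero _ (by omega), qBinom_eq_zero _ (by omega)]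
        · obtain ⟨C, hC⟩ := Nat.exists_eq_add_of_le hk
          rw [hC, show 2 * (k + C) + k = C + (k + C + 2 * k) by ring, ← gaussBinom_symm,
            gaussBinom]
          congr 1 <;> omega
      rw [sum_pairTerm_add hq (by omega), hs, mergedTerm, zpow_neg, zpow_neg, zpow_natCast,
        zpow_natCast, neg_sq, show (3 * (k : ℤ) ^ 2) = ((3 * k ^ 2 : ℕ) : ℤ) by push_cast; rfl,
        zpow_natCast, inv_pow, ← inv_pow (-1 : K), inv_neg_one]

theorem tripleSum_eq_sum_mergedTerm {q : K} (hq : ∀ m : ℕ, 0 < m → (q ^ 2) ^ m ≠ 1) (n : ℕ)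
    (z : K) : tripleSum n z q = ∑ m ∈ Icc (-n : ℤ) n, mergedTerm n z q m := by
  rw [← sum_congr rfl fun m hm => sum_pairTerm_eq_mergedTerm hq n z hm, sum_comm,
    tripleSum_eq_sum_pairTerm]
  refine sum_congr rfl fun h hh => ?_
  rw [sum_comm]
  refine sum_congr rfl fun i hi => ?_
  rw [mem_range] at hh hi
  rw [sum_ite_eq, if_pos (by rw [mem_Icc]; omega)]

end RamanujanFinite

theorem mainTheorem1 {K : Type*} [Field K] (z q : K) (hz : z ≠ 0)
    (hq : ∀ m : ℕ, 0 < m → q ^ m ≠ 1) (n : ℕ) :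
    (Function.support (RamanujanFinite.mainTerm n z q)).Finite ∧
    (2 ∣ n → (Function.support (RamanujanFinite.evenTerm n z q)).Finite) ∧
    (¬ 2 ∣ n → (Function.support (RamanujanFinite.oddTerm n z q)).Finite) ∧
    RamanujanFinite.tripleSum n z q =
      (∑ᶠ j : ℤ, RamanujanFinite.mainTerm n z q j) + RamanujanFinite.correction n z q := by
  have hq2 (m : ℕ) (hm : 0 < m) : (q ^ 2) ^ m ≠ 1 := by
    rw [← pow_mul]
    exact hq (2 * m) (by omega)
  exact ⟨(Set.finite_Icc _ _).subset (RamanujanFinite.support_mainTerm_subset n z q),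
    fun hn => RamanujanFinite.finite_support_evenTerm hn z q,
    fun hn => RamanujanFinite.finite_support_oddTerm hn z q,
    (RamanujanFinite.tripleSum_eq_sum_mergedTerm hq2 n z).trans
      (RamanujanFinite.finsum_mainTerm_add_correction hq2 n z).symm⟩
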